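/- Let $m,n\ge 1$ and $r\ge 0$ be integers. Write $x=(\operatorname{vec}A;\operatorname{vec}B;\operatorname{vec}S)$ with $A\in\mathbb R^{m\times r}$, $B\in\mathbb R^{n\times r}$, $S\in\mathbb R^{m\times n}$, use the Euclidean norm, and let $X$ be the set of $x$ all of whose entries lie in $[0,1]$. Let $C\in\mathbb R^{m\times n}$, $p\in\mathbb R^m$, $q\in\mathbb R^n$, $\lambda\ge 0$, $\beta>0$, $y=(y^p,y^q)\in\mathbb R^{m+n}$, $x_0\in X$. Let $\alpha_1,\dots,\alpha_{m+n}$ be the entries of $\big((AB^\top+S)\mathbf 1-p,\ (AB^\top+S)^\top\mathbf 1-q\big)$ as functions of $x$, and let $B_u$ be constants with $|\alpha_u(x)|\le B_u$ and $\|\nabla\alpha_u(x)\|\le B_u$ for all $x\in X$ and all $u$. Put $$\mathfrak L(x)=\langle C,AB^\top+S\rangle+\sum_u y_u\alpha_u(x)+\frac{\beta}{2}\sum_u\alpha_u(x)^2,$$ $$L=\sqrt{2r}\,\|C\|_F+\beta\sum_{u\le m}B_u\sqrt{2nr}+\beta\sum_{u>m}B_u\sqrt{2mr}+\beta\sum_uB_u^2+\sqrt{2r}\,(m\sqrt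 n+n\sqrt m)\,\|y\|,$$ $$G(x)=\mathfrak L(x)+L\|x-x_0\|^2,\qquad h(x)=\lambda\|S\|_1+\iota_X(x),\qquad F=G+h,\qquad F^*=\min_{X}F,$$ where $\iota_X$ is $0$ on $X$ and $+\infty$ elsewhere and $\|S\|_1=\sum_{ij}|S_{ij}|$. Algorithm BCD starts at $x_0$. In iteration $\tau=0,1,2,\dots$ it draws one of the three blocks $A,B,S$ uniformly at random, independently of the other iterations, and replaces only this block of $x_\tau$, where $A$ becomes $\operatorname{clamp}\big(A_\tau-\frac1{3L}\nabla_AG(x_\tau);0,1\big)$, $B$ becomes $\operatorname{clamp}\big(B_\tau-\frac1{3L}\nabla_BG(x_\tau);0,1\big)$, and $S$ becomes $\operatorname{clamp}\big(\operatorname{shrink}(S_\tau-\frac1{3L}\nabla_SG(x_\tau),\frac{\lambda}{3L});0,1\big)$, entrywise, with $\operatorname{shrink}(t,a)=\operatorname{sign}(t)\max(|t|-a,0)$ and $\operatorname{clamp}(t;l,u)=\max(l,\min(u,t))$. It stops at the first iterate $x$ with $\operatorname{dist}(-\nabla G(x),\partial h(x))\le\epsilon$ and outputs it, where $\partial h$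 is the convex subdifferential and the distance to the empty set is $+\infty$. Let $N_\epsilon$ be the number of iterations performed. Then for every $\epsilon>0$ the algorithm almost surely stops, with output $x$ satisfying $\operatorname{dist}(-\nabla G(x),\partial h(x))\le\epsilon$, after $\mathcal O(\log(1/\epsilon))$ iterations in expectation: for all data as above there is $c>0$, independent of $\epsilon$, with $$\mathbb E[N_\epsilon]\le c\log(1/\epsilon)\qquad\text{for all }0<\epsilon\le\tfrac12 .$$ More precisely, there is an absolute constant $K>0$ such that, for all data as above and all $\epsilon>0$, $$\mathbb E[N_\epsilon]\le K\Big(1+\log^+\frac{L\,(F(x_0)-F^*)}{\epsilon^2}\Big),\qquad \log^+ t=\max(0,\log t).$$ -/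

import Mathlib

open MeasureTheory ProbabilityTheory
open scoped ENNReal Matrix
universe u


noncomputable section

namespace SparseLowRankOT

/-- Coordinates of the stacked variable `x = (vec A; vec B; vec S)` with
`A ∈ ℝ^{m×r}`, `B ∈ ℝ^{n×r}`, `S ∈ ℝ^{m×n}`. -/
abbrev Coord (m n r : ℕ) : Type :=
  (Fin m × Fin r) ⊕ ((Fin n × Fin r) ⊕ (Fin m × Fin n))

/-- The space of the stacked variable, with the Euclidean norm. -/
abbrev Var (m n r : ℕ) : Type := EuclideanSpace ℝ (Coord m n r)

/-- The block (`0` for `A`, `1` for `B`, `2` for `S`) of a coordinate. -/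
def blockOf {m n r : ℕ} : Coord m n r → Fin 3
  | Sum.inl _ => 0
  | Sum.inr (Sum.inl _) => 1
  | Sum.inr (Sum.inr _) => 2

def partA {m n r : ℕ} (x : Var m n r) : Matrix (Fin m) (Fin r) ℝ :=
  Matrix.of fun i k => x (Sum.inl (i, k))

def partB {m n r : ℕ} (x : Var m n r) : Matrix (Fin n) (Fin r) ℝ :=
  Matrix.of fun j k => x (Sum.inr (Sum.inl (j, k)))

def partS {m n r : ℕ} (x : Var m n r) : Matrix (Fin m) (Fin n) ℝ :=
  Matrix.of fun i j => x (Sum.inr (Sum.inr (i, j)))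

/-- The transport plan `A Bᵀ + S`. -/
def plan {m n r : ℕ} (x : Var m n r) : Matrix (Fin m) (Fin n) ℝ :=
  partA x * (partB x)ᵀ + partS x

/-- All entries of `A`, `B`, `S` lie in `[0,1]`. -/
def box (m n r : ℕ) : Set (Var m n r) := {x | ∀ c, x c ∈ Set.Icc (0 : ℝ) 1}

/-- The data of one subproblem: cost matrix, marginals, sparsity weight, penalty parameter,
multipliers, the constants `bd u` that bound the constraint functions, and the starting point
(which is also the proximal centre). -/
structure Subproblem (m n r : ℕ) where
  cost : Matrix (Fin m) (Fin n) ℝ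
  p : Fin m → ℝ
  q : Fin n → ℝ
  lam : ℝ
  beta : ℝ
  y : EuclideanSpace ℝ (Fin m ⊕ Fin n)
  bd : Fin m ⊕ Fin n → ℝ
  x0 : Var m n r

namespace Subproblem

variable {m n r : ℕ} (P : Subproblem m n r)

/-- The constraint functions: `(ABᵀ + S) 1 - p` and `(ABᵀ + S)ᵀ 1 - q`. -/
def constr (u : Fin m ⊕ Fin n) (x : Var m n r) : ℝ :=
  match u with
  | Sum.inl i => (plan x *ᵥ 1) i - P.p i
  | Sum.inr j => ((plan x)ᵀ *ᵥ 1) j - P.q j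

/-- The smooth part of the augmented Lagrangian. -/
def augLagrangian (x : Var m n r) : ℝ :=
  (∑ i, ∑ j, P.cost i j * plan x i j) + (∑ u, P.y u * P.constr u x)
    + P.beta / 2 * ∑ u, P.constr u x ^ 2

/-- Each `bd u` bounds the `u`-th constraint function and the norm of its gradient on the box. -/
def BoundsConstraints : Prop :=
  ∀ u, ∀ x ∈ box m n r, |P.constr u x| ≤ P.bd u ∧ ‖gradient (P.constr u) x‖ ≤ P.bd u

/-- The smoothness constant `L(y, β)`. -/
def L : ℝ :=
  √(2 * r) * √(∑ i, ∑ j, P.cost i j ^ 2)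
    + P.beta * (∑ i : Fin m, P.bd (Sum.inl i) * √(2 * n * r))
    + P.beta * (∑ j : Fin n, P.bd (Sum.inr j) * √(2 * m * r))
    + P.beta * (∑ u, P.bd u ^ 2)
    + √(2 * r) * (m * √n + n * √m) * ‖P.y‖

/-- The smooth part of the subproblem: the augmented Lagrangian plus a proximal term. -/
def G (x : Var m n r) : ℝ := P.augLagrangian x + P.L * ‖x - P.x0‖ ^ 2

/-- The entrywise norm term `λ ‖S‖₁`. -/
def penalty (x : Var m n r) : ℝ := P.lam * ∑ i, ∑ j, |partS x i j|

open Classical in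
/-- The nonsmooth part: `λ ‖S‖₁` plus the indicator function of the box. -/
def h (x : Var m n r) : EReal := if x ∈ box m n r then (P.penalty x : EReal) else ⊤

/-- The objective `G + h` on the box, where it is finite. -/
def F (x : Var m n r) : ℝ := P.G x + P.penalty x

/-- The optimal value `F(x*)`. -/
def optVal : ℝ := sInf (P.F '' box m n r)

end Subproblem

/-- The convex subdifferential of an extended-real-valued function. -/
def subdifferential {E : Type*} [NormedAddCommGroup E] [InnerProductSpace ℝ E]
    (f : E → EReal) (x : E) : Set E :=
  {v | ∀ z, f x + ((inner ℝ v (z - x) : ℝ) : EReal) ≤ f z}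

def clamp (t l u : ℝ) : ℝ := max l (min u t)

/-- The shrinkage (soft-thresholding) operator. -/
def shrink (t a : ℝ) : ℝ := SignType.sign t * max (|t| - a) 0

namespace Subproblem

variable {m n r : ℕ} (P : Subproblem m n r)

/-- One iteration: the proximal gradient update with step `1 / (3 L)` of the block `b`;
the other two blocks are kept. -/
def step (b : Fin 3) (x : Var m n r) : Var m n r :=
  WithLp.toLp 2 fun c =>
    if blockOf c = b then
      (if blockOf c = 2 then
        clamp (shrink (x c - 1 / (3 * P.L) * gradient P.G x c) (P.lam / (3 * P.L))) 0 1
      else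
        clamp (x c - 1 / (3 * P.L) * gradient P.G x c) 0 1)
    else x c

/-- The iterate after `t` iterations, when iteration `s` updates the block `b s`. -/
def iterate (b : ℕ → Fin 3) : ℕ → Var m n r
  | 0 => P.x0
  | t + 1 => P.step (b t) (iterate b t)

/-- The termination test `dist(-∇G(x), ∂h(x)) ≤ ε`
(the distance to the empty set being infinite). -/
def IsStationary (ε : ℝ) (x : Var m n r) : Prop :=
  Metric.infEDist (-gradient P.G x) (subdifferential P.h x) ≤ ENNReal.ofReal ε

/-- The number of iterations performed until the termination test succeeds
(`⊤` if it never does). -/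
def numIter (ε : ℝ) (b : ℕ → Fin 3) : ℕ∞ :=
  ⨅ (t : ℕ) (_ : P.IsStationary ε (P.iterate b t)), (t : ℕ∞)

end Subproblem

/-- The block choices are independent and uniform on the three blocks. -/
structure IsUniformSampling {Ω : Type*} [MeasurableSpace Ω] (μ : Measure Ω)
    (b : ℕ → Ω → Fin 3) : Prop where
  measurable : ∀ t, Measurable (b t)
  indep : iIndepFun b μ
  uniform : ∀ t k, μ (b t ⁻¹' {k}) = 1 / 3

end SparseLowRankOT

end

noncomputable section

namespace SparseLowRankOT

/-! On the box `|S| = S`, so the penalty is linear, the objective `F` is smooth there, and every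
block update is a projected gradient step for `F` (`step_eq_blockStep`). The augmented Lagrangian is
`L`-smooth on the box, and the proximal term contributes exactly `L ‖z - x‖ ^ 2` to the second-order
remainder. Hence `F` is strongly convex with modulus `L` and `3 L`-smooth (`isRegularOnBox`).

The quadratic model minimized by a step is separable, so summing over the blocks gives the decrease
of a full projected gradient step. Strong convexity then makes the expected gap shrink by `1 -
(1/3)(1/3) = 8/9` per iteration (`sum_step_gap_le`, `lintegral_gap_le`).

A small gap alone does not bound the distance to the subdifferential, because the normal cone of the
box jumps at the boundary. But once every block has been redrawn, each coordinate is the output of a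
clamp, whose optimality condition supplies a normal vector; the remaining error is controlled by the
Lipschitz constant and the small diameter of the later iterates (`exists_small_residual`).

So `N ≤ 2 t` unless the gap at time `t` is large or some block is missing from the draws in `[t, 2
t)`. Thus `N` is at most twice the number of bad times (`toENNReal_le_tsum_indicator`). Markov's
inequality and independence bound the probability of a bad time by `min 1 ((8/9)^t R) + 3 (2/3)^t`,
whose sum is logarithmic in `R`. -/

/-! ### Projection and soft-thresholding on the unit interval -/

lemma clamp_mem_Icc (t : ℝ) : clamp t 0 1 ∈ Set.Icc (0 : ℝ) 1 := by
  simp [clamp]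

/-- The variational inequality of the projection onto `[0,1]`. -/
lemma sub_clamp_mul_nonpos (t : ℝ) {z : ℝ} (hz : z ∈ Set.Icc (0 : ℝ) 1) :
    (t - clamp t 0 1) * (z - clamp t 0 1) ≤ 0 := by
  obtain ⟨h0, h1⟩ := hz
  unfold clamp
  rcases le_total t 0 with ht | ht
  · rw [min_eq_right (by linarith), max_eq_left ht]; nlinarith
  rcases le_total t 1 with ht' | ht'
  · rw [min_eq_right ht', max_eq_right ht]; simp
  · rw [min_eq_left ht', max_eq_right zero_le_one]; nlinarith

/-- Shrinking before clamping to `[0,1]` amounts to a shift. -/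
lemma clamp_shrink (t : ℝ) {a : ℝ} (ha : 0 ≤ a) :
    clamp (shrink t a) 0 1 = clamp (t - a) 0 1 := by
  unfold shrink
  rcases lt_trichotomy t 0 with ht | rfl | ht
  · have h1 : -(max (|t| - a) 0) ≤ 0 := by simp
    simp only [sign_neg ht, clamp, SignType.coe_neg_one, neg_one_mul]
    rw [min_eq_right (by linarith), max_eq_left h1, min_eq_right (by linarith),
      max_eq_left (by linarith)]
  · simp [clamp, ha]
  · simp only [sign_pos ht, clamp, SignType.coe_one, one_mul, abs_of_pos ht]
    rcases le_total (t - a) 0 with h | h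
    · rw [max_eq_right h, min_eq_right zero_le_one, min_eq_right (by linarith), max_eq_left h]
      simp
    · rw [max_eq_left h]

/-- First-order optimality of the clamped step: the vector it produces lies in the normal cone of
`[0,1]` at the new point. These vectors later supply the subgradients. -/
lemma sub_clamp_normal {M : ℝ} (hM : 0 < M) (x a : ℝ) {z : ℝ} (hz : z ∈ Set.Icc (0 : ℝ) 1) :
    (M * (x - clamp (x - 1 / M * a) 0 1) - a) * (z - clamp (x - 1 / M * a) 0 1) ≤ 0 := by
  have h := mul_le_mul_of_nonneg_left (sub_clamp_mul_nonpos (x - 1 / M * a) hz) hM.le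
  have e : M * (x - clamp (x - 1 / M * a) 0 1) - a
      = M * (x - 1 / M * a - clamp (x - 1 / M * a) 0 1) := by
    generalize clamp (x - 1 / M * a) 0 1 = p
    field_simp
    ring
  rw [e, mul_assoc]
  simpa using h

/-- The clamped gradient step minimizes the quadratic model over `[0,1]`. -/
lemma clamp_model_le {M : ℝ} (hM : 0 < M) (x a : ℝ) {z : ℝ} (hz : z ∈ Set.Icc (0 : ℝ) 1) :
    a * (clamp (x - 1 / M * a) 0 1 - x) + M / 2 * (clamp (x - 1 / M * a) 0 1 - x) ^ 2
      ≤ a * (z - x) + M / 2 * (z - x) ^ 2 := by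
  have h := sub_clamp_normal hM x a hz
  nlinarith [mul_nonneg hM.le (sq_nonneg (z - clamp (x - 1 / M * a) 0 1))]

/-! ### Randomized block descent for a strongly convex smooth function on a box -/

section BlockDescent

variable {ι κ : Type*} [Fintype ι] [DecidableEq κ]

/-- The points of Euclidean space with all coordinates in `[0,1]`. -/
def unitBox (ι : Type*) [Fintype ι] : Set (EuclideanSpace ℝ ι) :=
  {x | ∀ c, x c ∈ Set.Icc (0 : ℝ) 1}

lemma convex_unitBox : Convex ℝ (unitBox ι) := by
  intro x hx z hz a b ha hb hab c
  exact convex_Icc (0 : ℝ) 1 (hx c) (hz c) ha hb hab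

lemma isCompact_unitBox : IsCompact (unitBox ι) := by
  have h : IsCompact (Set.univ.pi fun _ : ι => Set.Icc (0 : ℝ) 1) :=
    isCompact_univ_pi fun _ => isCompact_Icc
  have e : unitBox ι = (EuclideanSpace.equiv ι ℝ).toHomeomorph ⁻¹'
      (Set.univ.pi fun _ : ι => Set.Icc (0 : ℝ) 1) := by
    ext x
    simp only [unitBox, Set.mem_ofPred_eq, Set.mem_preimage, Set.mem_univ_pi]
    rfl
  rw [e]
  exact (Homeomorph.isCompact_preimage _).2 h

/-- On the unit box, `f` with gradient `g` is strongly convex with modulus `L` and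
`3 L`-smooth. -/
structure IsRegularOnBox (f : EuclideanSpace ℝ ι → ℝ)
    (g : EuclideanSpace ℝ ι → EuclideanSpace ℝ ι) (L : ℝ) : Prop where
  pos : 0 < L
  lower : ∀ x ∈ unitBox ι, ∀ z ∈ unitBox ι,
    f x + inner ℝ (g x) (z - x) + L / 2 * ‖z - x‖ ^ 2 ≤ f z
  upper : ∀ x ∈ unitBox ι, ∀ z ∈ unitBox ι,
    f z ≤ f x + inner ℝ (g x) (z - x) + 3 * L / 2 * ‖z - x‖ ^ 2
  lipschitz : ∀ x ∈ unitBox ι, ∀ z ∈ unitBox ι, ‖g z - g x‖ ≤ 3 * L * ‖z - x‖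

/-- The projected gradient step with step size `1 / M` on the coordinates of the block `b`. -/
def blockStep (bl : ι → κ) (g : EuclideanSpace ℝ ι → EuclideanSpace ℝ ι) (M : ℝ) (b : κ)
    (x : EuclideanSpace ℝ ι) : EuclideanSpace ℝ ι :=
  WithLp.toLp 2 fun c => if bl c = b then clamp (x c - 1 / M * g x c) 0 1 else x c

variable {bl : ι → κ} {f : EuclideanSpace ℝ ι → ℝ}
  {g : EuclideanSpace ℝ ι → EuclideanSpace ℝ ι} {L M : ℝ}

omit [Fintype ι] in
lemma blockStep_apply (b : κ) (x : EuclideanSpace ℝ ι) (c : ι) :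
    blockStep bl g M b x c = if bl c = b then clamp (x c - 1 / M * g x c) 0 1 else x c := rfl

lemma blockStep_mem (b : κ) {x : EuclideanSpace ℝ ι} (hx : x ∈ unitBox ι) :
    blockStep bl g M b x ∈ unitBox ι := by
  intro c
  rw [blockStep_apply]
  split_ifs
  exacts [clamp_mem_Icc _, hx c]

lemma inner_eq_sum (x z : EuclideanSpace ℝ ι) : inner ℝ x z = ∑ c, x c * z c := by
  simp [PiLp.inner_apply, mul_comm]

namespace IsRegularOnBox

variable (hf : IsRegularOnBox f g L)
include hf

lemma step_le_sum (b : κ) {x : EuclideanSpace ℝ ι} (hx : x ∈ unitBox ι) :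
    f (blockStep bl g (3 * L) b x) ≤ f x + ∑ c, if bl c = b then
      g x c * (clamp (x c - 1 / (3 * L) * g x c) 0 1 - x c)
        + 3 * L / 2 * (clamp (x c - 1 / (3 * L) * g x c) 0 1 - x c) ^ 2 else 0 := by
  have h := hf.upper x hx _ (blockStep_mem (bl := bl) (g := g) (M := 3 * L) b hx)
  rw [inner_eq_sum, EuclideanSpace.real_norm_sq_eq, Finset.mul_sum, add_assoc,
    ← Finset.sum_add_distrib] at h
  refine h.trans (le_of_eq ?_)
  congr 1
  refine Finset.sum_congr rfl fun c _ => ?_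
  simp only [PiLp.sub_apply, blockStep_apply]
  split_ifs <;> simp

lemma step_le (b : κ) {x : EuclideanSpace ℝ ι} (hx : x ∈ unitBox ι) :
    f (blockStep bl g (3 * L) b x) ≤ f x := by
  have h := hf.step_le_sum (bl := bl) b hx
  have hL : 0 < 3 * L := by linarith [hf.pos]
  have h2 : (∑ c, if bl c = b then
      g x c * (clamp (x c - 1 / (3 * L) * g x c) 0 1 - x c)
        + 3 * L / 2 * (clamp (x c - 1 / (3 * L) * g x c) 0 1 - x c) ^ 2 else 0) ≤ 0 := by
    refine Finset.sum_nonpos fun c _ => ?_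
    split_ifs
    · simpa using clamp_model_le hL (x c) (g x c) (hx c)
    · exact le_rfl
  linarith

/-- Each coordinate belongs to exactly one block, so the block models add up to the full separable
model, which the clamped step minimizes coordinatewise; any `z` in the box may be used for
comparison. -/
lemma sum_step_le [Fintype κ] {x z : EuclideanSpace ℝ ι} (hx : x ∈ unitBox ι)
    (hz : z ∈ unitBox ι) :
    ∑ b, f (blockStep bl g (3 * L) b x)
      ≤ Fintype.card κ * f x + inner ℝ (g x) (z - x) + 3 * L / 2 * ‖z - x‖ ^ 2 := by
  have hL : 0 < 3 * L := by linarith [hf.pos]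
  refine (Finset.sum_le_sum fun b _ => hf.step_le_sum (bl := bl) b hx).trans ?_
  rw [Finset.sum_add_distrib, Finset.sum_const, Finset.card_univ, nsmul_eq_mul, add_assoc,
    Finset.sum_comm, inner_eq_sum, EuclideanSpace.real_norm_sq_eq, Finset.mul_sum,
    ← Finset.sum_add_distrib]
  gcongr with c
  simpa using clamp_model_le hL (x c) (g x c) (hz c)

/-- Averaged over the blocks, the gap to any point of the box contracts. -/
lemma sum_step_gap_le [Fintype κ] {x z : EuclideanSpace ℝ ι} (hx : x ∈ unitBox ι)
    (hz : z ∈ unitBox ι) :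
    ∑ b, (f (blockStep bl g (3 * L) b x) - f z) ≤ (Fintype.card κ - 1 / 3) * (f x - f z) := by
  -- The fraction `1/3` is the ratio of the two moduli: `3 L / 2 * (1/3)^2 = 1/3 * (L / 2)`, so the
  -- model at this point is `1/3` of the strong convexity lower bound.
  have hw : x + (1 / 3 : ℝ) • (z - x) ∈ unitBox ι :=
    convex_unitBox.add_smul_sub_mem hx hz ⟨by norm_num, by norm_num⟩
  have h := hf.sum_step_le (bl := bl) hx hw
  have h2 := hf.lower x hx z hz
  rw [add_sub_cancel_left, inner_smul_right, norm_smul, mul_pow] at h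
  norm_num at h
  rw [Finset.sum_sub_distrib, Finset.sum_const, Finset.card_univ, nsmul_eq_mul]
  nlinarith

/-- Adding the strong convexity bounds from the midpoint towards `x` and towards `z` cancels the
gradient terms, so no optimality condition at `z` is needed. -/
lemma growth {x z : EuclideanSpace ℝ ι} (hx : x ∈ unitBox ι) (hz : z ∈ unitBox ι)
    (hmin : ∀ w ∈ unitBox ι, f z ≤ f w) : L / 4 * ‖x - z‖ ^ 2 ≤ f x - f z := by
  have hw : x + (1 / 2 : ℝ) • (z - x) ∈ unitBox ι :=
    convex_unitBox.add_smul_sub_mem hx hz ⟨by norm_num, by norm_num⟩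
  set w := x + (1 / 2 : ℝ) • (z - x) with hw'
  have e1 : x - w = (1 / 2 : ℝ) • (x - z) := by rw [hw']; module
  have e2 : z - w = -((1 / 2 : ℝ) • (x - z)) := by rw [hw']; module
  have h1 := hf.lower w hw x hx
  have h2 := hf.lower w hw z hz
  have h3 := hmin w hw
  rw [e1] at h1
  rw [e2, inner_neg_right, norm_neg] at h2
  rw [norm_smul, mul_pow] at h1 h2
  norm_num at h1 h2
  linarith

omit [Fintype ι] hf in
/-- A block that has been updated keeps the value of its last update. -/
lemma exists_last_update {step : κ → EuclideanSpace ℝ ι → EuclideanSpace ℝ ι}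
    (hstep : ∀ b x c, bl c ≠ b → step b x c = x c)
    {b : ℕ → κ} {x : ℕ → EuclideanSpace ℝ ι} (hx : ∀ t, x (t + 1) = step (b t) (x t))
    {t : ℕ} (k : κ) (T : ℕ) (h : ∃ s, t ≤ s ∧ s < T ∧ b s = k) :
    ∃ s, t ≤ s ∧ s < T ∧ b s = k ∧ ∀ c, bl c = k → x T c = x (s + 1) c := by
  induction T with
  | zero => obtain ⟨s, _, hs, _⟩ := h; omega
  | succ T ih =>
    obtain ⟨s, hts, hs, hb⟩ := h
    by_cases hT : b T = k
    · exact ⟨T, by omega, by omega, hT, fun _ _ => rfl⟩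
    · have hsT : s ≠ T := fun h => hT (h ▸ hb)
      obtain ⟨s', h1, h2, h3, h4⟩ := ih ⟨s, hts, by omega, hb⟩
      refine ⟨s', h1, by omega, h3, fun c hc => ?_⟩
      rw [hx T, hstep _ _ _ (fun h => hT (by rw [← h, hc])), h4 c hc]

/-- Once the gap is small and every block has been updated since, the point is nearly
stationary. -/
lemma exists_small_residual [Fintype κ] {b : ℕ → κ} {x : ℕ → EuclideanSpace ℝ ι}
    (hx : ∀ t, x (t + 1) = blockStep bl g (3 * L) (b t) (x t)) (hbox : ∀ t, x t ∈ unitBox ι)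
    {z : EuclideanSpace ℝ ι} (hz : z ∈ unitBox ι) (hmin : ∀ w ∈ unitBox ι, f z ≤ f w)
    {δ : ℝ} {t T : ℕ} (htT : t ≤ T) (hδ : f (x t) - f z ≤ δ)
    (hb : ∀ k, ∃ s, t ≤ s ∧ s < T ∧ b s = k) :
    ∃ ν : EuclideanSpace ℝ ι, (∀ w ∈ unitBox ι, inner ℝ ν (w - x T) ≤ 0) ∧
      ‖g (x T) + ν‖ ^ 2 ≤ Fintype.card κ * (24 ^ 2 * (L * δ)) := by
  have hL := hf.pos
  have hδ0 : 0 ≤ δ := by linarith [hmin _ (hbox t)]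
  have hdec : ∀ s, t ≤ s → f (x s) - f z ≤ δ := by
    intro s hs
    induction s, hs using Nat.le_induction with
    | base => exact hδ
    | succ s hs ih => rw [hx s]; linarith [hf.step_le (bl := bl) (b s) (hbox s)]
  -- By `growth`, all iterates from time `t` on stay within `R` of the minimizer, since the gap
  -- never increases.
  obtain ⟨R, hR0, hR⟩ : ∃ R : ℝ, 0 ≤ R ∧ R ^ 2 = 4 * δ / L :=
    ⟨√(4 * δ / L), Real.sqrt_nonneg _, Real.sq_sqrt (by positivity)⟩
  have hball : ∀ s, t ≤ s → ‖x s - z‖ ≤ R := by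
    intro s hs
    have h1 := hf.growth (hbox s) hz hmin
    have h2 := hdec s hs
    refine abs_le_of_sq_le_sq' ?_ hR0 |>.2
    rw [hR, le_div_iff₀ hL]
    linarith
  have hpair : ∀ s s', t ≤ s → t ≤ s' → ‖x s - x s'‖ ≤ 2 * R := by
    intro s s' hs hs'
    calc ‖x s - x s'‖ = ‖(x s - z) - (x s' - z)‖ := by congr 1; abel
      _ ≤ ‖x s - z‖ + ‖x s' - z‖ := norm_sub_le _ _
      _ ≤ 2 * R := by linarith [hball s hs, hball s' hs']
  choose σ h1 h2 h3 h4 using fun k => exists_last_update (bl := bl)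
    (step := blockStep bl g (3 * L))
    (fun b x c hc => by rw [blockStep_apply, if_neg hc]) hx k T (hb k)
  have h5 : ∀ c, x T c = clamp (x (σ (bl c)) c - 1 / (3 * L) * g (x (σ (bl c))) c) 0 1 := by
    intro c
    rw [h4 _ c rfl, hx, blockStep_apply, if_pos (h3 _).symm]
  -- The residual of block `k`, whose last update took place at time `σ k`. Both terms are at most
  -- `3 L * 2 R`, which gives `(12 L R)^2 = 24^2 L δ`.
  let e : κ → EuclideanSpace ℝ ι := fun k =>
    (g (x T) - g (x (σ k))) + (3 * L) • (x (σ k) - x (σ k + 1))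
  have he : ∀ k, ‖e k‖ ^ 2 ≤ 24 ^ 2 * (L * δ) := by
    intro k
    have hT := h2 k
    have a1 := hf.lipschitz _ (hbox (σ k)) _ (hbox T)
    have a2 := hpair T (σ k) htT (h1 k)
    have a3 := hpair (σ k) (σ k + 1) (h1 k) (by linarith [h1 k])
    have a4 : ‖e k‖ ≤ 12 * L * R := by
      refine (norm_add_le _ _).trans ?_
      rw [norm_smul, Real.norm_of_nonneg (by positivity : (0 : ℝ) ≤ 3 * L)]
      nlinarith
    calc ‖e k‖ ^ 2 ≤ (12 * L * R) ^ 2 := by gcongr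
      _ = 24 ^ 2 * (L * δ) := by rw [mul_pow, hR]; field_simp; ring
  -- In each coordinate, the normal vector of the clamp that last set it; the gradient is taken at
  -- the iterate before that update.
  refine ⟨WithLp.toLp 2 fun c => 3 * L * (x (σ (bl c)) c - x T c) - g (x (σ (bl c))) c,
    fun w hw => ?_, ?_⟩
  · rw [inner_eq_sum]
    refine Finset.sum_nonpos fun c _ => ?_
    simp only [PiLp.sub_apply, h5 c]
    exact sub_clamp_normal (by positivity) _ _ (hw c)
  · rw [EuclideanSpace.real_norm_sq_eq]
    calc _ = ∑ c, (e (bl c) c) ^ 2 := by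
          refine Finset.sum_congr rfl fun c _ => ?_
          simp only [e, PiLp.add_apply, PiLp.sub_apply, PiLp.smul_apply, smul_eq_mul,
            h4 _ c rfl]
          ring
      -- Enlarging each block residual to all coordinates is what costs the factor `Fintype.card κ`.
      _ ≤ ∑ c, ∑ k, (e k c) ^ 2 := Finset.sum_le_sum fun c _ =>
          Finset.single_le_sum (f := fun k => (e k c) ^ 2) (fun _ _ => sq_nonneg _)
            (Finset.mem_univ _)
      _ = ∑ k, ‖e k‖ ^ 2 := by
          rw [Finset.sum_comm]
          simp only [EuclideanSpace.real_norm_sq_eq]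
      _ ≤ _ := by
          refine (Finset.sum_le_sum fun k _ => he k).trans ?_
          simp

end IsRegularOnBox

end BlockDescent

/-! ### The transport plan as a quadratic map, and Frobenius bounds -/

section Bilinear

variable {m n r : ℕ} (W : Matrix (Fin m) (Fin n) ℝ)

/-- The bilinear form `⟨W, A_d B_eᵀ⟩`. -/
def bilin (d e : Var m n r) : ℝ :=
  ∑ i, ∑ j, W i j * ∑ k, d (Sum.inl (i, k)) * e (Sum.inr (Sum.inl (j, k)))

/-- The linear functional `⟨W, S_d⟩`. -/
def linS (d : Var m n r) : ℝ := ∑ i, ∑ j, W i j * d (Sum.inr (Sum.inr (i, j)))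

/-- The functional `⟨W, ABᵀ + S⟩`. -/
def planPairing (x : Var m n r) : ℝ := ∑ i, ∑ j, W i j * plan x i j

/-- The Frobenius norm. -/
def frob : ℝ := √(∑ i, ∑ j, W i j ^ 2)

lemma plan_apply (x : Var m n r) (i : Fin m) (j : Fin n) :
    plan x i j = ∑ k, x (Sum.inl (i, k)) * x (Sum.inr (Sum.inl (j, k)))
      + x (Sum.inr (Sum.inr (i, j))) := by
  simp [plan, partA, partB, partS, Matrix.mul_apply]

lemma bilin_add_left (d d' e : Var m n r) : bilin W (d + d') e = bilin W d e + bilin W d' e := by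
  simp only [bilin, PiLp.add_apply, add_mul, Finset.sum_add_distrib, mul_add]

lemma bilin_add_right (d e e' : Var m n r) : bilin W d (e + e') = bilin W d e + bilin W d e' := by
  simp only [bilin, PiLp.add_apply, Finset.sum_add_distrib, mul_add]

lemma linS_add (d e : Var m n r) : linS W (d + e) = linS W d + linS W e := by
  simp only [linS, PiLp.add_apply, Finset.sum_add_distrib, mul_add]

lemma planPairing_eq (x : Var m n r) : planPairing W x = bilin W x x + linS W x := by
  simp only [planPairing, bilin, linS, plan_apply, mul_add, Finset.sum_add_distrib]

/-- The derivative of `planPairing W`. -/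
def dPlanPairing (x : Var m n r) : Var m n r →L[ℝ] ℝ :=
  ∑ i, ∑ j, W i j • ((∑ k, (x (Sum.inl (i, k)) • EuclideanSpace.proj (Sum.inr (Sum.inl (j, k)))
    + x (Sum.inr (Sum.inl (j, k))) • EuclideanSpace.proj (Sum.inl (i, k))))
    + EuclideanSpace.proj (Sum.inr (Sum.inr (i, j))))

lemma hasFDerivAt_planPairing (x : Var m n r) :
    HasFDerivAt (planPairing W) (dPlanPairing W x) x := by
  have e : planPairing (r := r) W = fun x => ∑ i, ∑ j, W i j *
      (∑ k, x (Sum.inl (i, k)) * x (Sum.inr (Sum.inl (j, k))) + x (Sum.inr (Sum.inr (i, j)))) := by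
    funext x
    simp only [planPairing, plan_apply]
  have hp : ∀ c : Coord m n r, HasFDerivAt (fun x : Var m n r => x c)
      (EuclideanSpace.proj c : Var m n r →L[ℝ] ℝ) x := fun c =>
    (EuclideanSpace.proj c : Var m n r →L[ℝ] ℝ).hasFDerivAt
  rw [e]
  refine HasFDerivAt.fun_sum fun i _ => HasFDerivAt.fun_sum fun j _ => ?_
  refine HasFDerivAt.const_mul (HasFDerivAt.add (HasFDerivAt.fun_sum fun k _ => ?_)
    (hp (Sum.inr (Sum.inr (i, j))))) (W i j)
  exact (hp (Sum.inl (i, k))).mul (hp (Sum.inr (Sum.inl (j, k))))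

lemma dPlanPairing_apply (x d : Var m n r) :
    dPlanPairing W x d = bilin W x d + bilin W d x + linS W d := by
  have hp : ∀ c : Coord m n r, (EuclideanSpace.proj c : Var m n r →L[ℝ] ℝ) d = d c :=
    fun _ => rfl
  simp only [dPlanPairing, sum_apply, smul_apply,
    add_apply, hp, smul_eq_mul, bilin, linS, mul_add,
    Finset.sum_add_distrib]
  congr 2
  simp only [mul_comm]

lemma planPairing_add (x d : Var m n r) :
    planPairing W (x + d) = planPairing W x + dPlanPairing W x d + bilin W d d := by
  simp only [planPairing_eq, dPlanPairing_apply, bilin_add_left, bilin_add_right, linS_add]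
  ring

lemma dPlanPairing_add (x d e : Var m n r) :
    dPlanPairing W (x + d) e = dPlanPairing W x e + (bilin W d e + bilin W e d) := by
  simp only [dPlanPairing_apply, bilin_add_left, bilin_add_right]
  ring

lemma frob_nonneg : 0 ≤ frob W := Real.sqrt_nonneg _

/-- Cauchy–Schwarz twice: over the entries of `W`, then over the inner index `k`. -/
lemma abs_bilin_le (d e : Var m n r) :
    |bilin W d e| ≤ frob W * (√(∑ p, d (Sum.inl p) ^ 2) * √(∑ p, e (Sum.inr (Sum.inl p)) ^ 2)) := by
  rw [frob, ← Real.sqrt_mul (by positivity), ← Real.sqrt_mul (by positivity)]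
  refine Real.abs_le_sqrt ?_
  have h1 : bilin W d e = ∑ p : Fin m × Fin n, W p.1 p.2 *
      ∑ k, d (Sum.inl (p.1, k)) * e (Sum.inr (Sum.inl (p.2, k))) := by
    rw [Fintype.sum_prod_type, bilin]
  rw [h1]
  refine (Finset.sum_mul_sq_le_sq_mul_sq _ _ _).trans ?_
  rw [Fintype.sum_prod_type]
  gcongr
  calc ∑ p : Fin m × Fin n, (∑ k, d (Sum.inl (p.1, k)) * e (Sum.inr (Sum.inl (p.2, k)))) ^ 2
      ≤ ∑ p : Fin m × Fin n, (∑ k, d (Sum.inl (p.1, k)) ^ 2)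
          * ∑ k, e (Sum.inr (Sum.inl (p.2, k))) ^ 2 :=
        Finset.sum_le_sum fun p _ => Finset.sum_mul_sq_le_sq_mul_sq _ _ _
    _ = _ := by
        rw [Fintype.sum_prod_type, Fintype.sum_prod_type, Fintype.sum_prod_type,
          Finset.sum_mul_sum]

lemma sum_sq_parts_le (d : Var m n r) :
    ∑ p, d (Sum.inl p) ^ 2 + ∑ p, d (Sum.inr (Sum.inl p)) ^ 2 ≤ ‖d‖ ^ 2 := by
  rw [EuclideanSpace.real_norm_sq_eq, Fintype.sum_sum_type, Fintype.sum_sum_type, ← add_assoc]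
  have : 0 ≤ ∑ p, d (Sum.inr (Sum.inr p)) ^ 2 := by positivity
  linarith

lemma abs_bilin_add_bilin_le_frob (d e : Var m n r) :
    |bilin W d e + bilin W e d| ≤ frob W * (‖d‖ * ‖e‖) := by
  refine (abs_add_le _ _).trans ((add_le_add (abs_bilin_le W d e) (abs_bilin_le W e d)).trans ?_)
  rw [← mul_add]
  refine mul_le_mul_of_nonneg_left ?_ (frob_nonneg W)
  have hd := sum_sq_parts_le d
  have he := sum_sq_parts_le e
  rw [← Real.sq_sqrt (Finset.sum_nonneg fun p _ => sq_nonneg (d (Sum.inl p))),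
    ← Real.sq_sqrt (Finset.sum_nonneg fun p _ => sq_nonneg (d (Sum.inr (Sum.inl p))))] at hd
  rw [← Real.sq_sqrt (Finset.sum_nonneg fun p _ => sq_nonneg (e (Sum.inl p))),
    ← Real.sq_sqrt (Finset.sum_nonneg fun p _ => sq_nonneg (e (Sum.inr (Sum.inl p))))] at he
  generalize √(∑ p, d (Sum.inl p) ^ 2) = a at *
  generalize √(∑ p, d (Sum.inr (Sum.inl p)) ^ 2) = b at *
  generalize √(∑ p, e (Sum.inl p) ^ 2) = a' at *
  generalize √(∑ p, e (Sum.inr (Sum.inl p)) ^ 2) = b' at *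
  refine (abs_le_of_sq_le_sq' ?_ (by positivity)).2
  rw [mul_pow]
  calc (a * b' + a' * b) ^ 2 ≤ (a ^ 2 + b ^ 2) * (a' ^ 2 + b' ^ 2) := by
        nlinarith [sq_nonneg (a * a' - b * b')]
    _ ≤ _ := by gcongr

/-- The factor `√(2 * r)` only matches the form of `L`: it is at least `1` for `r ≥ 1`, and for `r =
0` the bilinear form vanishes. -/
lemma abs_bilin_add_bilin_le (d e : Var m n r) :
    |bilin W d e + bilin W e d| ≤ √(2 * r) * frob W * (‖d‖ * ‖e‖) := by
  rcases Nat.eq_zero_or_pos r with rfl | hr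
  · simp [bilin]
  · refine (abs_bilin_add_bilin_le_frob W d e).trans ?_
    have h1 : (1 : ℝ) ≤ √(2 * r) := by
      rw [Real.one_le_sqrt]
      have : (1 : ℝ) ≤ r := by exact_mod_cast hr
      linarith
    have h2 := frob_nonneg W
    have h3 : frob W ≤ √(2 * r) * frob W := le_mul_of_one_le_left h2 h1
    gcongr

lemma abs_bilin_self_le (d : Var m n r) :
    |bilin W d d| ≤ √(2 * r) * frob W / 2 * ‖d‖ ^ 2 := by
  have h := abs_bilin_add_bilin_le W d d
  rw [← two_mul, abs_mul, abs_two] at h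
  nlinarith

/-- The indicator matrix of a row or of a column. -/
def lineMatrix (u : Fin m ⊕ Fin n) : Matrix (Fin m) (Fin n) ℝ :=
  match u with
  | Sum.inl i => Matrix.of fun i' _ => if i' = i then 1 else 0
  | Sum.inr j => Matrix.of fun _ j' => if j' = j then 1 else 0

lemma frob_lineMatrix_inl (i : Fin m) : frob (lineMatrix (Sum.inl i) : Matrix (Fin m) (Fin n) ℝ)
    = √n := by
  simp [frob, lineMatrix]

lemma frob_lineMatrix_inr (j : Fin n) : frob (lineMatrix (Sum.inr j) : Matrix (Fin m) (Fin n) ℝ)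
    = √m := by
  simp [frob, lineMatrix]

end Bilinear

/-! ### Smoothness and strong convexity of the subproblem -/

namespace Subproblem

variable {m n r : ℕ} (P : Subproblem m n r)

lemma constr_eq (u : Fin m ⊕ Fin n) (x : Var m n r) :
    P.constr u x = planPairing (lineMatrix u) x - Sum.elim P.p P.q u := by
  rcases u with i | j
  · simp [constr, planPairing, lineMatrix, Matrix.mulVec, dotProduct]
  · simp [constr, planPairing, lineMatrix, Matrix.mulVec, dotProduct]

lemma hasFDerivAt_constr (u : Fin m ⊕ Fin n) (x : Var m n r) :
    HasFDerivAt (P.constr u) (dPlanPairing (lineMatrix u) x) x := by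
  rw [funext (P.constr_eq u)]
  exact (hasFDerivAt_planPairing _ x).sub_const _

lemma constr_add (u : Fin m ⊕ Fin n) (x d : Var m n r) :
    P.constr u (x + d) = P.constr u x + dPlanPairing (lineMatrix u) x d
      + bilin (lineMatrix u) d d := by
  rw [constr_eq, constr_eq, planPairing_add]
  ring

/-- The derivative of the augmented Lagrangian. -/
def dAugLagrangian (x : Var m n r) : Var m n r →L[ℝ] ℝ :=
  dPlanPairing P.cost x + ∑ u, P.y u • dPlanPairing (lineMatrix u) x
    + (P.beta / 2) • ∑ u, (2 * P.constr u x) • dPlanPairing (lineMatrix u) x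

lemma hasFDerivAt_augLagrangian (x : Var m n r) :
    HasFDerivAt P.augLagrangian (P.dAugLagrangian x) x := by
  refine ((hasFDerivAt_planPairing P.cost x).add (HasFDerivAt.fun_sum fun u _ =>
    (P.hasFDerivAt_constr u x).const_mul (P.y u))).add
    ((HasFDerivAt.fun_sum fun u _ => ?_).const_mul (P.beta / 2))
  simpa using (P.hasFDerivAt_constr u x).pow 2

lemma dAugLagrangian_apply (x d : Var m n r) :
    P.dAugLagrangian x d = dPlanPairing P.cost x d
      + ∑ u, P.y u * dPlanPairing (lineMatrix u) x d
      + P.beta * ∑ u, P.constr u x * dPlanPairing (lineMatrix u) x d := by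
  simp only [dAugLagrangian, add_apply, sum_apply,
    smul_apply, smul_eq_mul, mul_assoc, ← Finset.mul_sum]
  ring

lemma norm_gradient_eq {E : Type*} [NormedAddCommGroup E] [InnerProductSpace ℝ E]
    [CompleteSpace E] {f : E → ℝ} {f' : E →L[ℝ] ℝ} {x : E} (h : HasFDerivAt f f' x) :
    ‖gradient f x‖ = ‖f'‖ := by
  rw [← h.fderiv, ← toDual_gradient, LinearIsometryEquiv.norm_map]

lemma bounds_le_L :
    √(2 * r) * frob P.cost + ∑ u, |P.y u| * (√(2 * r) * frob (lineMatrix u))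
      + P.beta * ∑ u, (P.bd u ^ 2 + P.bd u * (√(2 * r) * frob (lineMatrix u))) ≤ P.L := by
  have hy : ∀ u, |P.y u| ≤ ‖P.y‖ := fun u => PiLp.norm_apply_le P.y u
  have h1 : ∑ u, |P.y u| * (√(2 * r) * frob (lineMatrix u))
      ≤ √(2 * r) * (m * √n + n * √m) * ‖P.y‖ := by
    refine (Finset.sum_le_sum fun u _ => mul_le_mul_of_nonneg_right (hy u)
      (mul_nonneg (Real.sqrt_nonneg _) (frob_nonneg _))).trans (le_of_eq ?_)
    simp only [Fintype.sum_sum_type, frob_lineMatrix_inl, frob_lineMatrix_inr, Finset.sum_const,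
      Finset.card_univ, Fintype.card_fin, nsmul_eq_mul]
    ring
  have e : ∀ k : ℕ, √(2 * k * r : ℝ) = √(2 * r) * √k := fun k => by
    rw [← Real.sqrt_mul (by positivity)]
    congr 1
    ring
  rw [Finset.sum_add_distrib, Fintype.sum_sum_type
    (fun u => P.bd u * (√(2 * r) * frob (lineMatrix u)))]
  simp only [frob_lineMatrix_inl, frob_lineMatrix_inr, L, e]
  rw [frob]
  linarith

section Bounds

variable {P} (hP : P.BoundsConstraints)
include hP

lemma abs_dPlanPairing_le (u : Fin m ⊕ Fin n) {x : Var m n r} (hx : x ∈ box m n r)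
    (e : Var m n r) : |dPlanPairing (lineMatrix u) x e| ≤ P.bd u * ‖e‖ := by
  have h := (hP u x hx).2
  rw [norm_gradient_eq (P.hasFDerivAt_constr u x)] at h
  exact ((dPlanPairing (lineMatrix u) x).le_opNorm e).trans (by gcongr)

lemma abs_constr_sub_le (u : Fin m ⊕ Fin n) {x z : Var m n r} (hx : x ∈ box m n r)
    (hz : z ∈ box m n r) : |P.constr u z - P.constr u x| ≤ P.bd u * ‖z - x‖ := by
  refine Convex.norm_image_sub_le_of_norm_hasFDerivWithin_le (s := box m n r)
    (fun x _ => (P.hasFDerivAt_constr u x).hasFDerivWithinAt) (fun x hx => ?_)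
    convex_unitBox hx hz
  rw [← norm_gradient_eq (P.hasFDerivAt_constr u x)]
  exact (hP u x hx).2

lemma bd_nonneg (u : Fin m ⊕ Fin n) {x : Var m n r} (hx : x ∈ box m n r) : 0 ≤ P.bd u :=
  (abs_nonneg _).trans (hP u x hx).1

/-- The constraint of row `i` has slope `1` along an `S`-coordinate of that row, so its gradient
does not vanish. This is what makes `L` positive. -/
lemma bd_inl_pos (hn : 0 < n) (i : Fin m) {x : Var m n r} (hx : x ∈ box m n r) :
    0 < P.bd (Sum.inl i) := by
  have h := abs_dPlanPairing_le hP (Sum.inl i) hx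
    (EuclideanSpace.single (Sum.inr (Sum.inr (i, ⟨0, hn⟩))) 1)
  have e : dPlanPairing (lineMatrix (Sum.inl i)) x
      (EuclideanSpace.single (Sum.inr (Sum.inr (i, ⟨0, hn⟩))) 1) = 1 := by
    simp [dPlanPairing_apply, bilin, linS, lineMatrix, Prod.ext_iff, ite_and]
  rw [e] at h
  simp at h
  linarith

lemma L_pos {x : Var m n r} (hx : x ∈ box m n r) (hβ : 0 < P.beta) (hm : 0 < m) (hn : 0 < n) :
    0 < P.L := by
  refine lt_of_lt_of_le ?_ (P.bounds_le_L)
  have h1 : 0 ≤ √(2 * r) * frob P.cost + ∑ u, |P.y u| * (√(2 * r) * frob (lineMatrix u)) :=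
    add_nonneg (mul_nonneg (Real.sqrt_nonneg _) (frob_nonneg _)) (Finset.sum_nonneg fun u _ =>
      mul_nonneg (abs_nonneg _) (mul_nonneg (Real.sqrt_nonneg _) (frob_nonneg _)))
  have h2 : ∀ u, 0 ≤ P.bd u * (√(2 * r) * frob (lineMatrix u)) := fun u =>
    mul_nonneg (bd_nonneg hP u hx) (mul_nonneg (Real.sqrt_nonneg _) (frob_nonneg _))
  have h3 : 0 < ∑ u, (P.bd u ^ 2 + P.bd u * (√(2 * r) * frob (lineMatrix u))) := by
    refine Finset.sum_pos' (fun u _ => add_nonneg (sq_nonneg _) (h2 u))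
      ⟨Sum.inl ⟨0, hm⟩, Finset.mem_univ _, ?_⟩
    have := bd_inl_pos hP hn ⟨0, hm⟩ hx
    exact add_pos_of_pos_of_nonneg (by positivity) (h2 _)
  positivity

/-- The gradient of the augmented Lagrangian is `L`-Lipschitz on the box. -/
lemma abs_dAugLagrangian_sub_le (hβ : 0 < P.beta) {x z : Var m n r} (hx : x ∈ box m n r)
    (hz : z ∈ box m n r) (e : Var m n r) :
    |P.dAugLagrangian z e - P.dAugLagrangian x e| ≤ P.L * (‖z - x‖ * ‖e‖) := by
  obtain ⟨d, rfl⟩ : ∃ d, z = x + d := ⟨z - x, by abel⟩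
  rw [add_sub_cancel_left]
  have key : P.dAugLagrangian (x + d) e - P.dAugLagrangian x e
      = (bilin P.cost d e + bilin P.cost e d)
        + ∑ u, P.y u * (bilin (lineMatrix u) d e + bilin (lineMatrix u) e d)
        + P.beta * ∑ u, ((P.constr u (x + d) - P.constr u x) * dPlanPairing (lineMatrix u) (x + d) e
          + P.constr u x * (bilin (lineMatrix u) d e + bilin (lineMatrix u) e d)) := by
    -- Product rule for differences: one term pairs two first-order bounds and gives `bd u ^ 2`; the
    -- other pairs `bd u` with the change of derivative.
    have e1 : ∀ u, (P.constr u (x + d) - P.constr u x) * dPlanPairing (lineMatrix u) (x + d) e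
          + P.constr u x * (bilin (lineMatrix u) d e + bilin (lineMatrix u) e d)
        = P.constr u (x + d) * dPlanPairing (lineMatrix u) (x + d) e
          - P.constr u x * dPlanPairing (lineMatrix u) x e := fun u => by
      rw [dPlanPairing_add _ x d e]; ring
    simp only [e1]
    rw [dAugLagrangian_apply, dAugLagrangian_apply, Finset.sum_sub_distrib]
    simp only [dPlanPairing_add _ x d e, mul_add, Finset.sum_add_distrib]
    ring
  rw [key]
  refine le_trans ?_ (mul_le_mul_of_nonneg_right (P.bounds_le_L) (by positivity))
  rw [add_mul, add_mul, mul_assoc P.beta, Finset.sum_mul, Finset.sum_mul]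
  refine (abs_add_le _ _).trans (add_le_add ((abs_add_le _ _).trans (add_le_add ?_ ?_)) ?_)
  · exact abs_bilin_add_bilin_le _ _ _
  · refine (Finset.abs_sum_le_sum_abs _ _).trans (Finset.sum_le_sum fun u _ => ?_)
    rw [abs_mul, mul_assoc]
    gcongr
    exact abs_bilin_add_bilin_le _ _ _
  · rw [abs_mul, abs_of_pos hβ]
    gcongr
    refine (Finset.abs_sum_le_sum_abs _ _).trans (Finset.sum_le_sum fun u _ => ?_)
    rw [add_mul]
    have h0 := bd_nonneg hP u hx
    have h1 := abs_constr_sub_le hP u hx hz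
    rw [add_sub_cancel_left] at h1
    refine (abs_add_le _ _).trans (add_le_add ?_ ?_)
    · rw [abs_mul]
      calc _ ≤ (P.bd u * ‖d‖) * (P.bd u * ‖e‖) := by
            gcongr
            exact abs_dPlanPairing_le hP u hz e
        _ = _ := by ring
    · rw [abs_mul, mul_assoc]
      gcongr
      · exact (hP u x hx).1
      · exact abs_bilin_add_bilin_le _ _ _

lemma abs_augLagrangian_sub_le (hβ : 0 < P.beta) {x z : Var m n r} (hx : x ∈ box m n r)
    (hz : z ∈ box m n r) :
    |P.augLagrangian z - P.augLagrangian x - P.dAugLagrangian x (z - x)|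
      ≤ P.L / 2 * ‖z - x‖ ^ 2 := by
  obtain ⟨d, rfl⟩ : ∃ d, z = x + d := ⟨z - x, by abel⟩
  rw [add_sub_cancel_left]
  have hcost : ∀ x, P.augLagrangian x = planPairing P.cost x + (∑ u, P.y u * P.constr u x)
    + P.beta / 2 * ∑ u, P.constr u x ^ 2 := fun _ => rfl
  -- The constraints are quadratic in `x`, so this second-order remainder is an exact identity.
  have key : P.augLagrangian (x + d) - P.augLagrangian x - P.dAugLagrangian x d
      = bilin P.cost d d + ∑ u, P.y u * bilin (lineMatrix u) d d
        + P.beta * ∑ u, ((P.constr u (x + d) - P.constr u x) ^ 2 / 2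
          + P.constr u x * bilin (lineMatrix u) d d) := by
    have e1 : ∀ u, (P.constr u (x + d) - P.constr u x) ^ 2 / 2
          + P.constr u x * bilin (lineMatrix u) d d
        = P.constr u (x + d) ^ 2 / 2 - P.constr u x ^ 2 / 2
          - P.constr u x * dPlanPairing (lineMatrix u) x d := fun u => by
      rw [constr_add]; ring
    simp only [e1]
    rw [dAugLagrangian_apply, hcost, hcost, Finset.sum_sub_distrib, Finset.sum_sub_distrib,
      planPairing_add, ← Finset.sum_div, ← Finset.sum_div,
      Finset.sum_congr rfl fun u _ => congrArg (P.y u * ·) (P.constr_add u x d)]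
    simp only [mul_add, Finset.sum_add_distrib]
    ring
  rw [key]
  have hd : P.L / 2 * ‖d‖ ^ 2 = P.L * (‖d‖ ^ 2 / 2) := by ring
  rw [hd]
  refine le_trans ?_ (mul_le_mul_of_nonneg_right (P.bounds_le_L) (by positivity))
  rw [add_mul, add_mul, mul_assoc P.beta, Finset.sum_mul, Finset.sum_mul]
  have hb : ∀ W : Matrix (Fin m) (Fin n) ℝ,
      |bilin W d d| ≤ √(2 * r) * frob W * (‖d‖ ^ 2 / 2) := fun W =>
    (abs_bilin_self_le W d).trans (le_of_eq (by ring))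
  refine (abs_add_le _ _).trans (add_le_add ((abs_add_le _ _).trans (add_le_add ?_ ?_)) ?_)
  · exact hb _
  · refine (Finset.abs_sum_le_sum_abs _ _).trans (Finset.sum_le_sum fun u _ => ?_)
    rw [abs_mul, mul_assoc]
    gcongr
    exact hb _
  · rw [abs_mul, abs_of_pos hβ]
    gcongr
    refine (Finset.abs_sum_le_sum_abs _ _).trans (Finset.sum_le_sum fun u _ => ?_)
    rw [add_mul]
    have h0 := bd_nonneg hP u hx
    have h1 := abs_constr_sub_le hP u hx hz
    rw [add_sub_cancel_left] at h1
    refine (abs_add_le _ _).trans (add_le_add ?_ ?_)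
    · rw [abs_div, abs_two, abs_pow]
      calc _ ≤ (P.bd u * ‖d‖) ^ 2 / 2 := by gcongr
        _ = _ := by ring
    · rw [abs_mul, mul_assoc]
      gcongr
      · exact (hP u x hx).1
      · exact hb _

end Bounds

lemma inner_gradient_G (x d : Var m n r) :
    inner ℝ (gradient P.G x) d = P.dAugLagrangian x d + 2 * P.L * inner ℝ (x - P.x0) d := by
  have h : HasFDerivAt P.G _ x := (P.hasFDerivAt_augLagrangian x).add
    ((((hasFDerivAt_id x).sub_const P.x0).norm_sq).const_mul P.L)
  rw [inner_gradient_left, h.fderiv]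
  simp only [add_apply, smul_apply,
    ContinuousLinearMap.comp_apply, ContinuousLinearMap.id_apply, innerSL_apply_apply,
    smul_eq_mul, nsmul_eq_mul, id]
  push_cast
  ring

/-- On the box the penalty is the linear functional with these coefficients. -/
def weight : Var m n r := WithLp.toLp 2 fun c => if blockOf c = 2 then P.lam else 0

lemma penalty_eq_inner {x : Var m n r} (hx : x ∈ box m n r) :
    P.penalty x = inner ℝ P.weight x := by
  rw [inner_eq_sum]
  simp only [Fintype.sum_sum_type, Fintype.sum_prod_type, weight, blockOf, penalty, partS,
    Matrix.of_apply, Finset.mul_sum]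
  simp
  refine Finset.sum_congr rfl fun i _ => Finset.sum_congr rfl fun j _ => ?_
  rw [abs_of_nonneg (hx _).1]

/-- The gradient of the objective, which is smooth on the box. -/
def objGradient (x : Var m n r) : Var m n r := gradient P.G x + P.weight

/-- The remainder of the augmented Lagrangian lies within `± L / 2 * ‖z - x‖ ^ 2`; the proximal term
adds exactly `L * ‖z - x‖ ^ 2`, leaving `L / 2` below and `3 L / 2` above. Likewise the gradient has
Lipschitz constant `L + 2 L`. -/
lemma isRegularOnBox {P : Subproblem m n r} (hP : P.BoundsConstraints) (hβ : 0 < P.beta)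
    (hm : 0 < m) (hn : 0 < n) (hx0 : P.x0 ∈ box m n r) :
    IsRegularOnBox P.F P.objGradient P.L where
  pos := L_pos hP hx0 hβ hm hn
  lower x hx z hz := by
    have h := (abs_le.1 (abs_augLagrangian_sub_le hP hβ hx hz)).1
    rw [F, F, G, G, P.penalty_eq_inner hx, P.penalty_eq_inner hz, objGradient, inner_add_left,
      inner_gradient_G, inner_sub_right P.weight]
    have e : ‖z - P.x0‖ ^ 2 = ‖x - P.x0‖ ^ 2 + 2 * inner ℝ (x - P.x0) (z - x) + ‖z - x‖ ^ 2 := by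
      rw [← norm_add_sq_real]; congr 2; abel
    rw [e]
    linarith
  upper x hx z hz := by
    have h := (abs_le.1 (abs_augLagrangian_sub_le hP hβ hx hz)).2
    rw [F, F, G, G, P.penalty_eq_inner hx, P.penalty_eq_inner hz, objGradient, inner_add_left,
      inner_gradient_G, inner_sub_right P.weight]
    have e : ‖z - P.x0‖ ^ 2 = ‖x - P.x0‖ ^ 2 + 2 * inner ℝ (x - P.x0) (z - x) + ‖z - x‖ ^ 2 := by
      rw [← norm_add_sq_real]; congr 2; abel
    rw [e]
    linarith
  lipschitz x hx z hz := by
    rw [objGradient, objGradient, add_sub_add_right_eq_sub]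
    have hL := L_pos hP hx0 hβ hm hn
    -- The gradient difference is tested against itself, and one factor `‖e‖` is cancelled at the
    -- end.
    set e := gradient P.G z - gradient P.G x with he
    have h1 : ‖e‖ ^ 2 = (P.dAugLagrangian z e - P.dAugLagrangian x e)
        + 2 * P.L * inner ℝ (z - x) e := by
      rw [← real_inner_self_eq_norm_sq]
      nth_rewrite 1 [he]
      rw [inner_sub_left, inner_gradient_G, inner_gradient_G]
      have : z - x = (z - P.x0) - (x - P.x0) := by abel
      rw [this, inner_sub_left (z - P.x0)]
      ring
    have h2 := (abs_le.1 (abs_dAugLagrangian_sub_le hP hβ hx hz e)).2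
    have h3 := real_inner_le_norm (z - x) e
    have h4 : ‖e‖ * ‖e‖ ≤ 3 * P.L * ‖z - x‖ * ‖e‖ := by
      nlinarith
    rcases (norm_nonneg e).eq_or_lt with h | h
    · rw [← h]; positivity
    · exact le_of_mul_le_mul_right h4 h

lemma step_eq_blockStep (hlam : 0 ≤ P.lam) (hL : 0 < P.L) (b : Fin 3) (x : Var m n r) :
    P.step b x = blockStep blockOf P.objGradient (3 * P.L) b x := by
  ext c
  rw [blockStep_apply]
  simp only [step, objGradient, PiLp.add_apply, weight]
  have : 0 ≤ P.lam / (3 * P.L) := by positivity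
  split_ifs
  · rw [clamp_shrink _ this]
    congr 1
    ring
  · simp
  · rfl

/-- On the box `h` is linear with coefficients `P.weight`, so adding a normal vector of the box to
`P.weight` gives a subgradient of `h`. -/
lemma isStationary_of_normal {x ν : Var m n r} (hx : x ∈ box m n r)
    (hν : ∀ w ∈ box m n r, inner ℝ ν (w - x) ≤ 0) {ε : ℝ} (hε : ‖P.objGradient x + ν‖ ≤ ε) :
    P.IsStationary ε x := by
  have hmem : P.weight + ν ∈ subdifferential P.h x := by
    intro z
    by_cases hz : z ∈ box m n r
    · rw [h, h, if_pos hx, if_pos hz, P.penalty_eq_inner hx, P.penalty_eq_inner hz]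
      norm_cast
      have := hν z hz
      rw [inner_add_left, inner_sub_right P.weight]
      linarith
    · rw [h, h, if_neg hz]
      exact le_top
  refine (Metric.infEDist_le_edist_of_mem hmem).trans ?_
  rw [edist_dist, dist_eq_norm]
  refine ENNReal.ofReal_le_ofReal (le_trans (le_of_eq ?_) hε)
  rw [← norm_neg]
  congr 1
  simp only [objGradient]
  abel

end Subproblem

/-! ### Random block choices -/

section Sampling

variable {Ω : Type*} [MeasurableSpace Ω] {μ : Measure Ω} {b : ℕ → Ω → Fin 3}

namespace Subproblem

variable {m n r : ℕ} (P : Subproblem m n r)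

lemma iterate_congr {b b' : ℕ → Fin 3} (t : ℕ) (h : ∀ s < t, b s = b' s) :
    P.iterate b t = P.iterate b' t := by
  induction t with
  | zero => rfl
  | succ t ih => rw [iterate, iterate, ih fun s hs => h s (by omega), h t (by omega)]

/-- The `t`-th iterate depends on the first `t` block choices only. -/
lemma exists_iterate_eq {Ω : Type*} (b : ℕ → Ω → Fin 3) (t : ℕ) :
    ∃ Φ : (Finset.range t → Fin 3) → Var m n r,
      ∀ ω, P.iterate (fun s => b s ω) t = Φ fun s => b s ω := by
  refine ⟨fun φ => P.iterate (fun s => if h : s ∈ Finset.range t then φ ⟨s, h⟩ else 0) t,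
    fun ω => P.iterate_congr t fun s hs => ?_⟩
  rw [dif_pos (Finset.mem_range.2 hs)]

/-- No regularity of `V` is needed: the iterate is a function of finitely many draws from a finite
set. -/
lemma measurable_comp_iterate (hb : ∀ t, Measurable (b t)) (V : Var m n r → ℝ≥0∞) (t : ℕ) :
    Measurable fun ω => V (P.iterate (fun s => b s ω) t) := by
  obtain ⟨Φ, hΦ⟩ := P.exists_iterate_eq b t
  simp only [hΦ]
  exact (measurable_of_countable fun φ => V (Φ φ)).comp
    (measurable_pi_lambda _ fun s => hb s)

/-- The expectation after one more iteration averages over the blocks. -/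
lemma lintegral_iterate_succ (hb : IsUniformSampling μ b) (V : Var m n r → ℝ≥0∞) (t : ℕ) :
    ∫⁻ ω, V (P.iterate (fun s => b s ω) (t + 1)) ∂μ
      = 1 / 3 * ∫⁻ ω, ∑ k, V (P.step k (P.iterate (fun s => b s ω) t)) ∂μ := by
  have hind : ∀ k, MeasurableSet (b t ⁻¹' {k}) := fun k =>
    hb.measurable t (measurableSet_singleton k)
  have hm : ∀ k, Measurable fun ω => V (P.step k (P.iterate (fun s => b s ω) t)) := fun k =>
    P.measurable_comp_iterate hb.measurable (fun x => V (P.step k x)) t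
  have e : ∀ ω, V (P.iterate (fun s => b s ω) (t + 1)) = ∑ k,
      V (P.step k (P.iterate (fun s => b s ω) t)) * (b t ⁻¹' {k}).indicator 1 ω := by
    intro ω
    rw [Finset.sum_eq_single (b t ω)]
    · simp [iterate]
    · intro k _ hk
      simp [hk.symm]
    · simp
  simp only [e]
  rw [lintegral_finsetSum (f := fun k ω => V (P.step k (P.iterate (fun s => b s ω) t))
      * (b t ⁻¹' {k}).indicator 1 ω) _ fun k _ =>
        (hm k).mul (measurable_one.indicator (hind k)),
    lintegral_finsetSum _ fun k _ => hm k, Finset.mul_sum]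
  refine Finset.sum_congr rfl fun k _ => ?_
  obtain ⟨Φ, hΦ⟩ := P.exists_iterate_eq b t
  -- The current iterate is a function of the draws before `t`, hence independent of the draw at
  -- time `t`.
  have hi : IndepFun (fun ω => V (P.step k (P.iterate (fun s => b s ω) t)))
      ((b t ⁻¹' {k}).indicator (1 : Ω → ℝ≥0∞)) μ := by
    have h := hb.indep.indepFun_finset (Finset.range t) {t} (by simp) hb.measurable
    have h' := h.comp (φ := fun φ => V (P.step k (Φ φ)))
      (ψ := fun ψ => ({k} : Set (Fin 3)).indicator (1 : Fin 3 → ℝ≥0∞)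
        (ψ ⟨t, Finset.mem_singleton_self t⟩))
      (measurable_of_countable _) (measurable_of_countable _)
    simp only [hΦ]
    exact h'
  rw [lintegral_mul_eq_lintegral_mul_lintegral_of_indepFun'' (hm k).aemeasurable
    (measurable_one.indicator (hind k)).aemeasurable hi, lintegral_indicator_one (hind k),
    hb.uniform, mul_comm]

end Subproblem

lemma IsUniformSampling.measure_ne [IsProbabilityMeasure μ] (hb : IsUniformSampling μ b)
    (t : ℕ) (k : Fin 3) : μ (b t ⁻¹' {k}ᶜ) = ENNReal.ofReal (2 / 3) := by
  rw [Set.preimage_compl, measure_compl (hb.measurable t (measurableSet_singleton k))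
    (measure_ne_top _ _), measure_univ, hb.uniform]
  have : (1 / 3 : ℝ≥0∞) = ENNReal.ofReal (1 / 3) := by
    rw [ENNReal.ofReal_div_of_pos (by norm_num)]
    simp
  rw [this, ← ENNReal.ofReal_one, ← ENNReal.ofReal_sub _ (by norm_num)]
  norm_num

lemma IsUniformSampling.measure_forall_ne [IsProbabilityMeasure μ] (hb : IsUniformSampling μ b)
    (S : Finset ℕ) (k : Fin 3) :
    μ (⋂ s ∈ S, b s ⁻¹' {k}ᶜ) = ENNReal.ofReal ((2 / 3) ^ S.card) := by
  rw [hb.indep.measure_inter_preimage_eq_mul S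
    (fun _ _ => (measurableSet_singleton k).compl)]
  simp only [hb.measure_ne, Finset.prod_const]
  rw [ENNReal.ofReal_pow (by norm_num)]

end Sampling

/-! ### Truncated geometric series and counting of bad times -/

lemma tsum_ofReal_geometric {ρ : ℝ} (h0 : 0 ≤ ρ) (h1 : ρ < 1) :
    ∑' t : ℕ, ENNReal.ofReal (ρ ^ t) = ENNReal.ofReal (1 - ρ)⁻¹ := by
  rw [← ENNReal.ofReal_tsum_of_nonneg (fun t => pow_nonneg h0 t)
    (summable_geometric_of_lt_one h0 h1), tsum_geometric_of_lt_one h0 h1]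

lemma pow_mul_le_one_of_posLog_le {R : ℝ} (hR : 0 ≤ R) {T : ℕ} (hT : 9 * Real.posLog R ≤ T) :
    (8 / 9 : ℝ) ^ T * R ≤ 1 := by
  have h1 : R ≤ Real.exp (Real.posLog R) := by
    rcases hR.eq_or_lt with rfl | h
    · positivity
    · calc R = Real.exp (Real.log R) := (Real.exp_log h).symm
        _ ≤ _ := Real.exp_le_exp.2 (le_max_right _ _)
  have h2 : (8 / 9 : ℝ) ^ T ≤ Real.exp (-Real.posLog R) := by
    calc (8 / 9 : ℝ) ^ T ≤ Real.exp (-(1 / 9)) ^ T := by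
          gcongr
          linarith [Real.add_one_le_exp (-(1 / 9) : ℝ)]
      _ = Real.exp (T * -(1 / 9)) := (Real.exp_nat_mul _ _).symm
      _ ≤ _ := Real.exp_le_exp.2 (by linarith)
  calc (8 / 9 : ℝ) ^ T * R ≤ Real.exp (-Real.posLog R) * Real.exp (Real.posLog R) := by gcongr
    _ = 1 := by rw [← Real.exp_add]; simp

/-- A truncated geometric series grows logarithmically in its scale. -/
lemma tsum_min_one_geometric_le {R : ℝ} (hR : 0 ≤ R) :
    ∑' t : ℕ, min 1 (ENNReal.ofReal ((8 / 9) ^ t * R))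
      ≤ ENNReal.ofReal (9 * Real.posLog R + 10) := by
  -- After `T` terms the scale `R` has been absorbed and the tail is a geometric series of sum `9`;
  -- the rounding of `T` adds `1`.
  obtain ⟨T, hT1, hT2⟩ : ∃ T : ℕ, 9 * Real.posLog R ≤ T ∧ (T : ℝ) ≤ 9 * Real.posLog R + 1 :=
    ⟨⌈9 * Real.posLog R⌉₊, Nat.le_ceil _,
      (Nat.ceil_lt_add_one (mul_nonneg (by norm_num) Real.posLog_nonneg)).le⟩
  have hdecay := pow_mul_le_one_of_posLog_le hR hT1
  rw [← Summable.sum_add_tsum_nat_add'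
    (f := fun t : ℕ => min 1 (ENNReal.ofReal ((8 / 9) ^ t * R))) (k := T) ENNReal.summable]
  have h1 : ∑ t ∈ Finset.range T, min 1 (ENNReal.ofReal ((8 / 9) ^ t * R))
      ≤ ENNReal.ofReal T := by
    refine (Finset.sum_le_card_nsmul _ _ 1 fun t _ => min_le_left _ _).trans (le_of_eq ?_)
    rw [Finset.card_range, nsmul_one, ENNReal.ofReal_natCast]
  have h2 : ∑' t : ℕ, min 1 (ENNReal.ofReal ((8 / 9) ^ (t + T) * R)) ≤ ENNReal.ofReal 9 := by
    calc _ ≤ ∑' t : ℕ, ENNReal.ofReal ((8 / 9 : ℝ) ^ t) := by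
          refine ENNReal.tsum_le_tsum fun t => (min_le_right _ _).trans ?_
          refine ENNReal.ofReal_le_ofReal ?_
          rw [pow_add, mul_assoc]
          exact mul_le_of_le_one_right (by positivity) hdecay
      _ = ENNReal.ofReal 9 := by
          rw [tsum_ofReal_geometric (by norm_num) (by norm_num)]
          norm_num
  refine (add_le_add h1 h2).trans ?_
  rw [← ENNReal.ofReal_add (by positivity) (by norm_num)]
  exact ENNReal.ofReal_le_ofReal (by linarith)

/-- A time that is at most `2 t` as soon as the `t`-th event fails is bounded by a count of
events. -/
lemma toENNReal_le_tsum_indicator {Ω : Type*} {C : ℕ → Set Ω} {ω : Ω} {N : ℕ∞}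
    (h : ∀ t, ω ∉ C t → N ≤ (2 * t : ℕ)) :
    (N : ℝ≥0∞) ≤ ∑' t, (C t).indicator (fun _ => 2) ω := by
  have key : ∀ k : ℕ, (k : ℕ∞) ≤ N → (k : ℝ≥0∞) ≤ ∑' t, (C t).indicator (fun _ => 2) ω := by
    intro k hk
    -- There are `(k + 1) / 2` times `t` with `2 * t < k`, and at each of them the event must hold
    -- if `k ≤ N`.
    refine le_trans ?_ (ENNReal.sum_le_tsum (Finset.range ((k + 1) / 2)))
    have h1 : ∑ t ∈ Finset.range ((k + 1) / 2), (C t).indicator (fun _ => (2 : ℝ≥0∞)) ω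
        = ∑ t ∈ Finset.range ((k + 1) / 2), 2 := by
      refine Finset.sum_congr rfl fun t ht => Set.indicator_of_mem ?_ _
      by_contra hC
      have h2 : k ≤ 2 * t := by exact_mod_cast hk.trans (h t hC)
      have := Finset.mem_range.1 ht
      omega
    rw [h1, Finset.sum_const, Finset.card_range, nsmul_eq_mul]
    have h2 : k ≤ (k + 1) / 2 * 2 := by omega
    exact_mod_cast h2
  cases N with
  | top => exact le_of_eq (ENNReal.eq_top_of_forall_nnreal_le fun x => by
      obtain ⟨k, hk⟩ := exists_nat_ge x
      exact le_trans (by exact_mod_cast hk) (key k le_top)).symm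
  | coe k => exact key k le_rfl

/-! ### Expected number of iterations -/

namespace Subproblem

variable {m n r : ℕ} {P : Subproblem m n r}

lemma numIter_le {ε : ℝ} {b : ℕ → Fin 3} {t : ℕ} (h : P.IsStationary ε (P.iterate b t)) :
    P.numIter ε b ≤ t := iInf₂_le t h

lemma exists_numIter_eq {ε : ℝ} {b : ℕ → Fin 3} (h : P.numIter ε b ≠ ⊤) :
    ∃ T : ℕ, P.numIter ε b = T ∧ P.IsStationary ε (P.iterate b T) := by
  classical
  have hex : ∃ t, P.IsStationary ε (P.iterate b t) := by
    by_contra! hno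
    exact h (by simp [numIter, hno])
  refine ⟨Nat.find hex, le_antisymm (numIter_le (Nat.find_spec hex)) ?_, Nat.find_spec hex⟩
  exact le_iInf₂ fun t ht => by exact_mod_cast Nat.find_min' hex ht

lemma continuousOn_F : ContinuousOn P.F (box m n r) := by
  have h1 : Continuous P.augLagrangian :=
    continuous_iff_continuousAt.2 fun x => (P.hasFDerivAt_augLagrangian x).continuousAt
  have h2 : Continuous P.G := by
    unfold G
    fun_prop
  have h3 : Continuous fun x : Var m n r => inner ℝ P.weight x := by fun_prop
  exact (h2.add h3).continuousOn.congr fun x hx => by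
    rw [F, P.penalty_eq_inner hx, Pi.add_apply]

lemma exists_isMinOn_F (hx0 : P.x0 ∈ box m n r) :
    ∃ z ∈ box m n r, (∀ w ∈ box m n r, P.F z ≤ P.F w) ∧ P.optVal = P.F z := by
  obtain ⟨z, hz, hmin⟩ := isCompact_unitBox.exists_isMinOn ⟨P.x0, hx0⟩ P.continuousOn_F
  refine ⟨z, hz, fun w hw => hmin hw, IsLeast.csInf_eq ⟨Set.mem_image_of_mem _ hz, ?_⟩⟩
  rintro _ ⟨w, hw, rfl⟩
  exact hmin hw

section Convergence

variable {Ω : Type*} [MeasurableSpace Ω] {μ : Measure Ω} [IsProbabilityMeasure μ]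
  {b : ℕ → Ω → Fin 3}

variable (hlam : 0 ≤ P.lam) (hreg : IsRegularOnBox P.F P.objGradient P.L)
  (hx0 : P.x0 ∈ box m n r)
include hlam hreg hx0

lemma iterate_mem (b : ℕ → Fin 3) (t : ℕ) : P.iterate b t ∈ box m n r := by
  induction t with
  | zero => exact hx0
  | succ t ih =>
    rw [iterate, P.step_eq_blockStep hlam hreg.pos]
    exact blockStep_mem _ ih

/-- The expected optimality gap decays geometrically. -/
lemma lintegral_gap_le (hb : IsUniformSampling μ b) {z : Var m n r} (hz : z ∈ box m n r)
    (hmin : ∀ w ∈ box m n r, P.F z ≤ P.F w) (t : ℕ) :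
    ∫⁻ ω, ENNReal.ofReal (P.F (P.iterate (fun s => b s ω) t) - P.F z) ∂μ
      ≤ ENNReal.ofReal ((8 / 9) ^ t * (P.F P.x0 - P.F z)) := by
  induction t with
  | zero => simp [iterate]
  | succ t ih =>
    rw [P.lintegral_iterate_succ hb (fun x => ENNReal.ofReal (P.F x - P.F z)) t]
    -- The factor `8 / 3 = 3 - 1 / 3` comes from summing over three blocks; the probability `1 / 3`
    -- of each draw turns it into `8 / 9`.
    have h1 : ∀ ω, ∑ k, ENNReal.ofReal
        (P.F (P.step k (P.iterate (fun s => b s ω) t)) - P.F z)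
        ≤ ENNReal.ofReal (8 / 3)
          * ENNReal.ofReal (P.F (P.iterate (fun s => b s ω) t) - P.F z) := by
      intro ω
      have hx := iterate_mem hlam hreg hx0 (fun s => b s ω) t
      simp only [P.step_eq_blockStep hlam hreg.pos]
      rw [← ENNReal.ofReal_sum_of_nonneg fun k _ =>
          sub_nonneg.2 (hmin _ (blockStep_mem _ hx)),
        ← ENNReal.ofReal_mul (by norm_num)]
      refine ENNReal.ofReal_le_ofReal ((hreg.sum_step_gap_le hx hz).trans (le_of_eq ?_))
      norm_num
    calc _ ≤ 1 / 3 * ∫⁻ ω, ENNReal.ofReal (8 / 3)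
          * ENNReal.ofReal (P.F (P.iterate (fun s => b s ω) t) - P.F z) ∂μ := by
          gcongr with ω
          exact h1 ω
      _ ≤ 1 / 3 * (ENNReal.ofReal (8 / 3)
          * ENNReal.ofReal ((8 / 9) ^ t * (P.F P.x0 - P.F z))) := by
          rw [lintegral_const_mul' _ _ ENNReal.ofReal_ne_top]
          gcongr
      _ = _ := by
          have : (1 / 3 : ℝ≥0∞) = ENNReal.ofReal (1 / 3) := by
            rw [ENNReal.ofReal_div_of_pos (by norm_num)]
            simp
          rw [this, ← ENNReal.ofReal_mul (by norm_num), ← ENNReal.ofReal_mul (by norm_num)]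
          congr 1
          ring

/-- The iterate `2 t` is stationary when the gap was small at time `t` and every block has been
drawn since. -/
lemma isStationary_iterate_two_mul {b : ℕ → Fin 3} {z : Var m n r} (hz : z ∈ box m n r)
    (hmin : ∀ w ∈ box m n r, P.F z ≤ P.F w) {ε : ℝ} (hε : 0 < ε) {t : ℕ}
    (hgap : P.F (P.iterate b t) - P.F z ≤ ε ^ 2 / (1728 * P.L))
    (hall : ∀ k, ∃ s, t ≤ s ∧ s < 2 * t ∧ b s = k) :
    P.IsStationary ε (P.iterate b (2 * t)) := by
  have hL := hreg.pos
  obtain ⟨ν, hν, hres⟩ := hreg.exists_small_residual (bl := blockOf) (b := b)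
    (x := P.iterate b) (fun s => P.step_eq_blockStep hlam hreg.pos _ _)
    (iterate_mem hlam hreg hx0 b) hz hmin (by omega : t ≤ 2 * t) hgap hall
  refine P.isStationary_of_normal (iterate_mem hlam hreg hx0 b _) hν
    (abs_le_of_sq_le_sq' (hres.trans (le_of_eq ?_)) hε.le).2
  rw [Fintype.card_fin]
  field_simp
  norm_num

/-- The number of iterations is dominated by a measurable count of small expectation. -/
lemma exists_dominating_count (hb : IsUniformSampling μ b) {ε : ℝ} (hε : 0 < ε) :
    ∃ Y : Ω → ℝ≥0∞, Measurable Y ∧ (∀ ω, (P.numIter ε (fun t => b t ω) : ℝ≥0∞) ≤ Y ω) ∧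
      ∫⁻ ω, Y ω ∂μ ≤ ENNReal.ofReal
        (18 * Real.posLog (1728 * (P.L * (P.F P.x0 - P.optVal) / ε ^ 2)) + 38) := by
  have hL := hreg.pos
  obtain ⟨z, hz, hmin, hopt⟩ := exists_isMinOn_F hx0
  rw [hopt]
  -- Here `1728 = 3 * 24 ^ 2`: three blocks, each with squared residual at most `24 ^ 2 * (L * δ)`,
  -- so a gap of at most `δ` yields accuracy `ε`.
  set δ := ε ^ 2 / (1728 * P.L) with hδ
  have hδ0 : 0 < δ := by positivity
  set R := 1728 * (P.L * (P.F P.x0 - P.F z) / ε ^ 2) with hR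
  have hgap0 : 0 ≤ P.F P.x0 - P.F z := sub_nonneg.2 (hmin _ hx0)
  have hR0 : 0 ≤ R := by positivity
  let A : ℕ → Set Ω := fun t => {ω | ENNReal.ofReal δ
    ≤ ENNReal.ofReal (P.F (P.iterate (fun s => b s ω) t) - P.F z)}
  -- The window has length `t`, so a given block is missed with probability `(2/3)^t`. At `t = 0` it
  -- is empty and the event is everything.
  let B : ℕ → Fin 3 → Set Ω := fun t k => ⋂ s ∈ Finset.Ico t (2 * t), b s ⁻¹' {k}ᶜ
  let C : ℕ → Set Ω := fun t => A t ∪ ⋃ k, B t k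
  have hAmeas : ∀ t, Measurable fun ω =>
      ENNReal.ofReal (P.F (P.iterate (fun s => b s ω) t) - P.F z) := fun t =>
    P.measurable_comp_iterate hb.measurable (fun x => ENNReal.ofReal (P.F x - P.F z)) t
  have hC : ∀ t, MeasurableSet (C t) := fun t =>
    (measurableSet_le measurable_const (hAmeas t)).union (MeasurableSet.iUnion fun k =>
      Finset.measurableSet_biInter _ fun s _ =>
        hb.measurable s (measurableSet_singleton k).compl)
  have hμA : ∀ t, μ (A t) ≤ min 1 (ENNReal.ofReal ((8 / 9) ^ t * R)) := by
    intro t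
    refine le_min prob_le_one ((meas_ge_le_lintegral_div (hAmeas t).aemeasurable
      (ENNReal.ofReal_pos.2 hδ0).ne' ENNReal.ofReal_ne_top).trans ?_)
    refine (ENNReal.div_le_div_right (lintegral_gap_le hlam hreg hx0 hb hz hmin t) _).trans ?_
    rw [← ENNReal.ofReal_div_of_pos hδ0]
    refine ENNReal.ofReal_le_ofReal (le_of_eq ?_)
    rw [hδ, hR]
    field_simp
  have hμC : ∀ t, μ (C t) ≤ min 1 (ENNReal.ofReal ((8 / 9) ^ t * R))
      + 3 * ENNReal.ofReal ((2 / 3) ^ t) := by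
    intro t
    refine (measure_union_le _ _).trans (add_le_add (hμA t)
      ((measure_iUnion_fintype_le _ _).trans (le_of_eq ?_)))
    have e : 2 * t - t = t := by omega
    simp only [B, hb.measure_forall_ne, Nat.card_Ico, e]
    simp
  refine ⟨fun ω => ∑' t, (C t).indicator (fun _ => 2) ω,
    Measurable.tsum fun t => measurable_const.indicator (hC t), fun ω => ?_, ?_⟩
  · refine toENNReal_le_tsum_indicator fun t ht => numIter_le ?_
    simp only [C, A, B, Set.mem_union, Set.mem_iUnion, not_or, not_exists, Set.mem_ofPred_eq,
      not_le, Set.mem_iInter, not_forall, Finset.mem_Ico, Set.mem_preimage, Set.mem_compl_iff,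
      Set.mem_singleton_iff, not_not] at ht
    refine isStationary_iterate_two_mul hlam hreg hx0 hz hmin hε
      ((ENNReal.ofReal_lt_ofReal_iff hδ0).1 ht.1).le fun k => ?_
    obtain ⟨s, hs, hk⟩ := ht.2 k
    exact ⟨s, hs.1, hs.2, hk⟩
  · rw [lintegral_tsum fun t => (measurable_const.indicator (hC t)).aemeasurable]
    simp only [lintegral_indicator_const (hC _)]
    rw [ENNReal.tsum_mul_left]
    calc 2 * ∑' t, μ (C t)
        ≤ 2 * (ENNReal.ofReal (9 * Real.posLog R + 10) + 3 * ENNReal.ofReal 3) := by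
          gcongr
          refine (ENNReal.tsum_le_tsum hμC).trans ?_
          rw [ENNReal.tsum_add, ENNReal.tsum_mul_left,
            tsum_ofReal_geometric (by norm_num) (by norm_num)]
          refine add_le_add (tsum_min_one_geometric_le hR0) (le_of_eq ?_)
          norm_num
      _ = _ := by
          have h2 : (2 : ℝ≥0∞) = ENNReal.ofReal 2 := by simp
          have h3 : (3 : ℝ≥0∞) = ENNReal.ofReal 3 := by simp
          have hp := Real.posLog_nonneg (x := R)
          rw [h2, h3, ← ENNReal.ofReal_mul (by norm_num), ← ENNReal.ofReal_add (by positivity)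
            (by norm_num), ← ENNReal.ofReal_mul (by norm_num)]
          congr 1
          ring

end Convergence

end Subproblem

/-! ### Absorbing the constants -/

lemma posLog_1728_mul_le (x : ℝ) : Real.posLog (1728 * x) ≤ 1728 + Real.posLog x := by
  refine Real.posLog_mul.trans (add_le_add_left ?_ _)
  exact max_le (by norm_num) (Real.log_le_self (by norm_num))

lemma posLog_div_sq_le (x : ℝ) {ε : ℝ} (h0 : 0 < ε) (h1 : ε ≤ 1 / 2) :
    Real.posLog (x / ε ^ 2) ≤ Real.posLog x + 2 * Real.log (1 / ε) := by
  have hlog : 0 ≤ Real.log (1 / ε) := Real.log_nonneg (by rw [le_div_iff₀ h0]; linarith)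
  have e : Real.posLog ((1 / ε) ^ 2) = 2 * Real.log (1 / ε) := by
    rw [Real.posLog, Real.log_pow]
    exact max_eq_right (by positivity)
  calc Real.posLog (x / ε ^ 2) = Real.posLog (x * (1 / ε) ^ 2) := by
        congr 1; field_simp
    _ ≤ _ := Real.posLog_mul
    _ = _ := by rw [e]

/-- Domination by a measurable integrable count gives both claims without measurability of
`numIter`. The constant is `31142 = 18 * 1728 + 38`, from the crude bound `log 1728 ≤ 1728`. -/
lemma Subproblem.ae_numIter_ne_top_and_lintegral_le {m n r : ℕ} {P : Subproblem m n r}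
    (hm : 0 < m) (hn : 0 < n) (hlam : 0 ≤ P.lam) (hβ : 0 < P.beta) (hP : P.BoundsConstraints)
    (hx0 : P.x0 ∈ box m n r) {Ω : Type*} [MeasurableSpace Ω] {μ : Measure Ω}
    [IsProbabilityMeasure μ] {b : ℕ → Ω → Fin 3} (hb : IsUniformSampling μ b) {ε : ℝ}
    (hε : 0 < ε) :
    (∀ᵐ ω ∂μ, P.numIter ε (fun t => b t ω) ≠ ⊤) ∧
      ∫⁻ ω, (P.numIter ε (fun t => b t ω) : ℝ≥0∞) ∂μ ≤ ENNReal.ofReal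
        (31142 * (1 + Real.posLog (P.L * (P.F P.x0 - P.optVal) / ε ^ 2))) := by
  obtain ⟨Y, hY, hle, hint⟩ := Subproblem.exists_dominating_count hlam
    (Subproblem.isRegularOnBox hP hβ hm hn hx0) hx0 hb hε
  constructor
  · filter_upwards [ae_lt_top hY (hint.trans_lt ENNReal.ofReal_lt_top).ne] with ω hω htop
    have h := (hle ω).trans_lt hω
    rw [htop] at h
    simp at h
  · refine (lintegral_mono hle).trans (hint.trans (ENNReal.ofReal_le_ofReal ?_))
    have h1 := posLog_1728_mul_le (P.L * (P.F P.x0 - P.optVal) / ε ^ 2)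
    have h2 := Real.posLog_nonneg (x := P.L * (P.F P.x0 - P.optVal) / ε ^ 2)
    linarith

end SparseLowRankOT

end

theorem mainTheorem4 :
    ∃ K : ℝ, 0 < K ∧
      ∀ (m n r : ℕ) (P : SparseLowRankOT.Subproblem m n r),
        0 < m → 0 < n → 0 ≤ P.lam → 0 < P.beta →
        P.BoundsConstraints → P.x0 ∈ SparseLowRankOT.box m n r →
        (∃ c : ℝ, 0 < c ∧
          ∀ (Ω : Type u) [MeasurableSpace Ω] (μ : Measure Ω) [IsProbabilityMeasure μ]
            (b : ℕ → Ω → Fin 3), SparseLowRankOT.IsUniformSampling μ b →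
            ∀ ε : ℝ, 0 < ε → ε ≤ 1 / 2 →
              ∫⁻ ω, (P.numIter ε (fun t => b t ω) : ℝ≥0∞) ∂μ
                ≤ ENNReal.ofReal (c * Real.log (1 / ε))) ∧
        ∀ (Ω : Type u) [MeasurableSpace Ω] (μ : Measure Ω) [IsProbabilityMeasure μ]
          (b : ℕ → Ω → Fin 3), SparseLowRankOT.IsUniformSampling μ b →
          ∀ ε : ℝ, 0 < ε →
            (∀ᵐ ω ∂μ, ∃ T : ℕ, P.numIter ε (fun t => b t ω) = T ∧
              P.IsStationary ε (P.iterate (fun t => b t ω) T)) ∧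
            ∫⁻ ω, (P.numIter ε (fun t => b t ω) : ℝ≥0∞) ∂μ
              ≤ ENNReal.ofReal
                  (K * (1 + Real.posLog (P.L * (P.F P.x0 - P.optVal) / ε ^ 2))) := by
  refine ⟨31142, by norm_num, fun m n r P hm hn hlam hβ hP hx0 => ⟨?_, ?_⟩⟩
  · set Q := Real.posLog (P.L * (P.F P.x0 - P.optVal)) with hQ
    have hQ0 : 0 ≤ Q := Real.posLog_nonneg
    have hlog2 : 0 < Real.log 2 := Real.log_pos (by norm_num)
    -- The part independent of `ε` is absorbed using `log (1 / ε) ≥ log 2`; the summand `2` comes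
    -- from the square in `ε ^ 2`.
    refine ⟨31142 * ((1 + Q) / Real.log 2 + 2), by positivity, ?_⟩
    intro Ω _ μ _ b hb ε hε hε2
    refine (SparseLowRankOT.Subproblem.ae_numIter_ne_top_and_lintegral_le hm hn hlam hβ hP hx0 hb hε).2.trans
      (ENNReal.ofReal_le_ofReal ?_)
    have h1 := SparseLowRankOT.posLog_div_sq_le (P.L * (P.F P.x0 - P.optVal)) hε hε2
    have h2 : Real.log 2 ≤ Real.log (1 / ε) :=
      Real.log_le_log (by norm_num) (by rw [le_div_iff₀ hε]; linarith)
    have h3 : 1 + Q ≤ (1 + Q) / Real.log 2 * Real.log (1 / ε) := by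
      rw [div_mul_eq_mul_div, le_div_iff₀ hlog2]
      gcongr
    rw [mul_assoc, add_mul]
    exact mul_le_mul_of_nonneg_left (by linarith) (by norm_num)
  · intro Ω _ μ _ b hb ε hε
    obtain ⟨h1, h2⟩ := SparseLowRankOT.Subproblem.ae_numIter_ne_top_and_lintegral_le hm hn hlam hβ hP hx0 hb hε
    exact ⟨h1.mono fun ω hω => SparseLowRankOT.Subproblem.exists_numIter_eq hω, h2⟩
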